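/- Every rational in $(0,1)$ is written as a finite regular continued fraction $[a_1,\dots,a_n]=\cfrac{1}{a_1+\cfrac{1}{\ddots+\cfrac{1}{a_n}}}$ in reduced form, i.e. with $a_n\ge 2$. The Kepler tree is the infinite binary tree of rationals with root $1/2$ in which every node $p/q$ (in lowest terms) has left child $p/(p+q)$ and right child $q/(p+q)$. Reading it level by level from the root down, and each level from left to right, gives the sequence $\frac12,\ \frac13,\frac23,\ \frac14,\frac34,\frac25,\frac35,\ \frac15,\dots$ Concatenating the continued fraction expansions of these rationals in this order gives an infinite sequence of positive integers, and $$\mathcal K=[2,\ 3,\ 1,2,\ 4,\ 1,3,\ 2,2,\ 1,1,2,\ 5,\dots]$$ denotes the value of the corresponding infinite continued fraction. For $x\in[0,1)$ with partial quotients $a_1(x),a_2(x),\dots$ let $?(x)=2\sum_{i\ge1}(-1)^{i+1}2^{-(a_1(x)+\cdots+a_i(x))}$ (a finite sum if $x$ is rational), and let $\mu_?$ be the Minkowski question mark measure, i.e. the Borel probability measure on $[0,1)$ with distribution function $?$. For a block $d=d_1,\dots,d_k$ of positive integers ($k\ge1$) let $\Delta(d)$ be the set of $y\in[0,1)$ whose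 continued fraction expansion begins with $d_1,\dots,d_k$, and let $G_n(x,d)$ be the number of occurrences of $d$ in the first $n$ partial quotients of $x$. A number $x\in[0,1)$ is called Minkowski normal if for every $k\ge 1$ and every block $d=d_1,\dots,d_k$ of positive integers $$\lim_{n\to\infty}\frac1n G_n(x,d)=\mu_?(\Delta(d))=2^{-(d_1+\cdots+d_k)}.$$ Theorem. The convergents of the infinite continued fraction above converge, their limit $\mathcal K$ is an irrational number whose sequence of partial quotients is exactly the concatenated sequence, and $\mathcal K$ is Minkowski normal. -/

import Mathlib

open Filter Topology

noncomputable section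

namespace MinkowskiNormality

/-! ### Regular continued fraction digits -/

/-- `cfDigit x n` is the partial quotient `a_{n+1}(x)` in the regular continued fraction expansion
`x = [a_1, a_2, a_3, …]` of `x ∈ [0,1)`. If the expansion of `x` has at most `n` partial quotients
(so that `x` is rational), the value is `0`; genuine partial quotients are always positive. -/
def cfDigit (x : ℝ) (n : ℕ) : ℕ :=
  ((GenContFract.of x).partDens.get? n).elim 0 Nat.floor

/-- The finite list `[a_1, …, a_n]` of partial quotients of a rational number `q ∈ [0,1)`,
in reduced form (`a_n ≥ 2`). -/
def cfList (q : ℚ) : List ℕ :=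
  ((GenContFract.of q).s.toList (GenContFract.terminates_of_rat q)).map fun p => ⌊p.b⌋₊

/-! ### The Kepler tree and the number obtained by concatenation -/

/-- Left child of `p / q` in the Kepler tree: `p / (p + q)`. -/
def keplerLeft (x : ℚ) : ℚ := (x.num : ℚ) / ((x.num : ℚ) + (x.den : ℚ))

/-- Right child of `p / q` in the Kepler tree: `q / (p + q)`. -/
def keplerRight (x : ℚ) : ℚ := (x.den : ℚ) / ((x.num : ℚ) + (x.den : ℚ))

/-- The `l`-th level of the Kepler tree with root `1 / 2`, read from left to right. -/
def keplerLevel : ℕ → List ℚ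
  | 0 => [1 / 2]
  | l + 1 => (keplerLevel l).flatMap fun x => [keplerLeft x, keplerRight x]

/-- The concatenation of the continued fraction expansions of all rationals in the levels
`0, …, L - 1` of the Kepler tree, read top-down and left-right. -/
def keplerDigitList (L : ℕ) : List ℕ :=
  (List.range L).flatMap fun l => (keplerLevel l).flatMap cfList

/-- The `n`-th term (`n = 0, 1, 2, …`) of the infinite concatenation of the continued fraction
expansions of all rationals in the Kepler tree. The lists `keplerDigitList L` extend each other,
and the one for `L = n + 1` has at least `n + 1` entries, since every level contributes at least
one; so the default value is never used. -/
def keplerDigit (n : ℕ) : ℕ := (keplerDigitList (n + 1)).getD n 0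

/-- The infinite continued fraction `[2, 3, 1, 2, 4, 1, 3, 2, 2, 1, 1, 2, 5, …]`
(integer part `0`, all partial numerators `1`). -/
def keplerContFract : GenContFract ℝ where
  h := 0
  s := Stream'.Seq.ofStream fun n => ⟨1, (keplerDigit n : ℝ)⟩

/-- The number `𝒦`: the value of the infinite continued fraction `keplerContFract`, that is, the
limit of its convergents. -/
def keplerNumber : ℝ := limUnder atTop keplerContFract.convs

/-! ### The Minkowski question mark measure -/

/-- The terms `(-1)^{i+1} / 2^{a_1(x) + ⋯ + a_i(x)}` (here indexed from `i = 0`) of the question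
mark series; they are `0` beyond the end of a finite continued fraction expansion. -/
def questionMarkTerm (x : ℝ) (i : ℕ) : ℝ :=
  if cfDigit x i = 0 then 0
  else (-1) ^ i / 2 ^ (∑ j ∈ Finset.range (i + 1), cfDigit x j)

/-- Minkowski's question mark function on `[0,1)`, extended to a distribution function on `ℝ`
by `0` on the left and by `1` on the right. -/
def questionMark (x : ℝ) : ℝ :=
  if x < 0 then 0 else if x < 1 then 2 * ∑' i, questionMarkTerm x i else 1

lemma cfDigit_zero_left (n : ℕ) : cfDigit 0 n = 0 := by
  have h := GenContFract.of_s_of_int (K := ℝ) 0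
  simp only [Int.cast_zero] at h
  simp [cfDigit, GenContFract.partDens, h]

lemma fract_eq {x : ℝ} (h0 : 0 < x) (h1 : x < 1) : Int.fract x = x :=
  Int.fract_eq_self.2 ⟨h0.le, h1⟩

lemma cfDigit_zero_right {x : ℝ} (h0 : 0 < x) (h1 : x < 1) : cfDigit x 0 = ⌊x⁻¹⌋₊ := by
  have hf := fract_eq h0 h1
  have h := GenContFract.of_s_head (v := x) (by rw [hf]; exact h0.ne')
  rw [hf] at h
  change (GenContFract.of x).s.get? 0 = _ at h
  have hn : (⌊x⁻¹⌋₊ : ℤ) = ⌊x⁻¹⌋ := Int.natCast_floor_eq_floor (by positivity)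
  simp [cfDigit, GenContFract.partDens, Stream'.Seq.map_get?, h, ← hn]

lemma of_s_fract (y : ℝ) : (GenContFract.of (Int.fract y)).s = (GenContFract.of y).s := by
  ext1 n
  cases n with
  | zero =>
    by_cases h : Int.fract y = 0
    · obtain ⟨z, rfl⟩ : ∃ z : ℤ, (z : ℝ) = y := ⟨⌊y⌋, by
        have := Int.floor_add_fract y; rw [h] at this; linarith⟩
      have h2 := GenContFract.of_s_of_int (K := ℝ) 0
      simp only [Int.cast_zero] at h2
      rw [h, GenContFract.of_s_of_int, h2]
    · have e1 := GenContFract.of_s_head (v := y) h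
      have e2 := GenContFract.of_s_head (v := Int.fract y) (by rwa [Int.fract_fract])
      rw [Int.fract_fract] at e2
      exact e2.trans e1.symm
  | succ n => rw [GenContFract.of_s_succ, GenContFract.of_s_succ, Int.fract_fract]

lemma cfDigit_succ {x : ℝ} (h0 : 0 < x) (h1 : x < 1) (n : ℕ) :
    cfDigit x (n + 1) = cfDigit (Int.fract x⁻¹) n := by
  simp only [cfDigit, GenContFract.partDens, Stream'.Seq.map_get?, of_s_fract,
    GenContFract.of_s_succ, fract_eq h0 h1]

lemma one_le_floor_inv {x : ℝ} (h0 : 0 < x) (h1 : x < 1) : 1 ≤ ⌊x⁻¹⌋₊ :=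
  Nat.le_floor (by simpa using (one_le_inv₀ h0).2 h1.le)

lemma questionMarkTerm_zero_left (i : ℕ) : questionMarkTerm 0 i = 0 := by
  simp [questionMarkTerm, cfDigit_zero_left]

lemma questionMarkTerm_zero_right {x : ℝ} (h0 : 0 < x) (h1 : x < 1) :
    questionMarkTerm x 0 = ((2 : ℝ) ^ ⌊x⁻¹⌋₊)⁻¹ := by
  have := one_le_floor_inv h0 h1
  rw [questionMarkTerm, if_neg (by rw [cfDigit_zero_right h0 h1]; omega)]
  simp [cfDigit_zero_right h0 h1]

lemma questionMarkTerm_succ {x : ℝ} (h0 : 0 < x) (h1 : x < 1) (i : ℕ) :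
    questionMarkTerm x (i + 1)
      = -((2 : ℝ) ^ ⌊x⁻¹⌋₊)⁻¹ * questionMarkTerm (Int.fract x⁻¹) i := by
  rw [questionMarkTerm, questionMarkTerm, cfDigit_succ h0 h1]
  split_ifs with h
  · simp
  · rw [Finset.sum_range_succ' _ (i + 1), cfDigit_zero_right h0 h1]
    simp only [cfDigit_succ h0 h1]
    rw [pow_add _ _ ⌊x⁻¹⌋₊, pow_succ, div_eq_mul_inv, div_eq_mul_inv, mul_inv]
    ring

lemma inv_two_pow_le {x : ℝ} (h0 : 0 < x) (h1 : x < 1) :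
    ((2 : ℝ) ^ ⌊x⁻¹⌋₊)⁻¹ ≤ 1 / 2 := by
  rw [one_div]
  apply inv_anti₀ (by norm_num)
  simpa using pow_le_pow_right₀ (one_le_two (α := ℝ)) (one_le_floor_inv h0 h1)

lemma abs_questionMarkTerm_le (i : ℕ) :
    ∀ x : ℝ, 0 ≤ x → x < 1 → |questionMarkTerm x i| ≤ 1 / 2 * (1 / 2) ^ i := by
  induction i with
  | zero =>
    intro x h0 h1
    rcases h0.eq_or_lt with rfl | h0
    · simp [questionMarkTerm_zero_left]
    · rw [questionMarkTerm_zero_right h0 h1, abs_of_pos (by positivity)]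
      simpa using inv_two_pow_le h0 h1
  | succ i ih =>
    intro x h0 h1
    rcases h0.eq_or_lt with rfl | h0
    · rw [questionMarkTerm_zero_left, abs_zero]; positivity
    · rw [questionMarkTerm_succ h0 h1, abs_mul, abs_neg, abs_of_pos (by positivity)]
      calc _ ≤ 1 / 2 * (1 / 2 * (1 / 2 : ℝ) ^ i) :=
            mul_le_mul (inv_two_pow_le h0 h1) (ih _ (Int.fract_nonneg _) (Int.fract_lt_one _))
              (abs_nonneg _) (by norm_num)
        _ = _ := by ring

lemma summable_questionMarkTerm {x : ℝ} (h0 : 0 ≤ x) (h1 : x < 1) :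
    Summable (questionMarkTerm x) :=
  Summable.of_norm_bounded (g := fun i : ℕ => 1 / 2 * (1 / 2 : ℝ) ^ i)
    ((summable_geometric_of_lt_one (by norm_num) (by norm_num)).mul_left _)
    fun i => abs_questionMarkTerm_le i x h0 h1

lemma questionMark_zero : questionMark 0 = 0 := by
  simp [questionMark, questionMarkTerm_zero_left]

lemma questionMark_of_one_le {x : ℝ} (h : 1 ≤ x) : questionMark x = 1 := by
  rw [questionMark, if_neg (by linarith), if_neg (by linarith)]

lemma questionMark_of_mem {x : ℝ} (h0 : 0 ≤ x) (h1 : x < 1) :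
    questionMark x = 2 * ∑' i, questionMarkTerm x i := by
  rw [questionMark, if_neg (by linarith), if_pos h1]

lemma questionMark_rec {x : ℝ} (h0 : 0 < x) (h1 : x < 1) :
    questionMark x = ((2 : ℝ) ^ ⌊x⁻¹⌋₊)⁻¹ * (2 - questionMark (Int.fract x⁻¹)) := by
  rw [questionMark_of_mem h0.le h1,
    questionMark_of_mem (Int.fract_nonneg _) (Int.fract_lt_one _),
    (summable_questionMarkTerm h0.le h1).tsum_eq_zero_add, questionMarkTerm_zero_right h0 h1]
  simp only [questionMarkTerm_succ h0 h1]
  rw [tsum_mul_left]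
  ring

lemma abs_questionMark_le {x : ℝ} (h0 : 0 ≤ x) (h1 : x < 1) : |questionMark x| ≤ 2 := by
  have hs := (summable_geometric_of_lt_one (r := (1 / 2 : ℝ)) (by norm_num)
    (by norm_num)).mul_left (1 / 2)
  have := tsum_of_norm_bounded (f := questionMarkTerm x) hs.hasSum
    fun i => abs_questionMarkTerm_le i x h0 h1
  rw [tsum_mul_left, tsum_geometric_of_lt_one (by norm_num) (by norm_num),
    Real.norm_eq_abs] at this
  rw [questionMark_of_mem h0 h1, abs_mul, abs_of_pos (by norm_num : (0 : ℝ) < 2)]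
  norm_num at this
  linarith

lemma questionMark_bounds_aux (n : ℕ) : ∀ x : ℝ, 0 ≤ x → x < 1 →
    -(2 * (1 / 2) ^ n) ≤ questionMark x ∧ questionMark x ≤ 1 + 2 * (1 / 2) ^ n := by
  induction n with
  | zero =>
    intro x h0 h1
    have := abs_le.1 (abs_questionMark_le h0 h1)
    constructor <;> norm_num <;> linarith
  | succ n ih =>
    intro x h0 h1
    have hp : (0 : ℝ) < (1 / 2) ^ n := by positivity
    rcases h0.eq_or_lt with rfl | h0
    · rw [questionMark_zero, pow_succ]; constructor <;> linarith
    · obtain ⟨ha, hb⟩ := ih _ (Int.fract_nonneg x⁻¹) (Int.fract_lt_one x⁻¹)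
      have hc := inv_two_pow_le h0 h1
      have hd : (0 : ℝ) < ((2 : ℝ) ^ ⌊x⁻¹⌋₊)⁻¹ := by positivity
      rw [questionMark_rec h0 h1, pow_succ]
      constructor <;> nlinarith

lemma questionMark_mem_unit (x : ℝ) : 0 ≤ questionMark x ∧ questionMark x ≤ 1 := by
  by_cases h0 : x < 0
  · simp [questionMark, h0]
  by_cases h1 : x < 1
  · rw [not_lt] at h0
    have ht : Tendsto (fun n : ℕ => 2 * (1 / 2 : ℝ) ^ n) atTop (𝓝 0) := by
      simpa using (tendsto_pow_atTop_nhds_zero_of_lt_one (r := (1 / 2 : ℝ)) (by norm_num)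
        (by norm_num)).const_mul 2
    constructor
    · have h2 : Tendsto (fun n : ℕ => -(2 * (1 / 2 : ℝ) ^ n)) atTop (𝓝 0) := by
        simpa using ht.neg
      exact le_of_tendsto' h2 fun n => (questionMark_bounds_aux n x h0 h1).1
    · have h2 : Tendsto (fun n : ℕ => 1 + 2 * (1 / 2 : ℝ) ^ n) atTop (𝓝 1) := by
        simpa using ht.const_add 1
      exact ge_of_tendsto' h2 fun n => (questionMark_bounds_aux n x h0 h1).2
  · rw [questionMark_of_one_le (not_lt.1 h1)]; norm_num

lemma questionMark_mono_aux (n : ℕ) : ∀ x y : ℝ, 0 ≤ x → x ≤ y → y < 1 →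
    questionMark x - questionMark y ≤ (1 / 2) ^ n := by
  induction n with
  | zero =>
    intro x y _ _ _
    have := questionMark_mem_unit x
    have := questionMark_mem_unit y
    norm_num; linarith
  | succ n ih =>
    intro x y h0 hxy h1
    have hp : (0 : ℝ) < (1 / 2) ^ (n + 1) := by positivity
    rcases h0.eq_or_lt with rfl | h0
    · have := questionMark_mem_unit y
      rw [questionMark_zero]; linarith
    · have hy0 := h0.trans_le hxy
      have hx1 := hxy.trans_lt h1
      have hinv : y⁻¹ ≤ x⁻¹ := inv_anti₀ h0 hxy
      have hu := questionMark_mem_unit (Int.fract x⁻¹)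
      have hv := questionMark_mem_unit (Int.fract y⁻¹)
      have hfl : ⌊y⁻¹⌋₊ ≤ ⌊x⁻¹⌋₊ := Nat.floor_le_floor hinv
      have hd : (0 : ℝ) < ((2 : ℝ) ^ ⌊y⁻¹⌋₊)⁻¹ := by positivity
      rw [questionMark_rec h0 hx1, questionMark_rec hy0 h1]
      rcases hfl.lt_or_eq with h | h
      · have h2 : ((2 : ℝ) ^ ⌊x⁻¹⌋₊)⁻¹ ≤ ((2 : ℝ) ^ ⌊y⁻¹⌋₊)⁻¹ * (1 / 2) := by
          rw [one_div, ← mul_inv, ← pow_succ]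
          exact inv_anti₀ (by positivity) (pow_le_pow_right₀ one_le_two h)
        have hd' : (0 : ℝ) < ((2 : ℝ) ^ ⌊x⁻¹⌋₊)⁻¹ := by positivity
        nlinarith
      · have hfr : Int.fract y⁻¹ ≤ Int.fract x⁻¹ := by
          have e1 : (⌊x⁻¹⌋₊ : ℝ) = ⌊x⁻¹⌋ := natCast_floor_eq_intCast_floor (by positivity)
          have e2 : (⌊y⁻¹⌋₊ : ℝ) = ⌊y⁻¹⌋ := natCast_floor_eq_intCast_floor (by positivity)
          rw [h] at e2
          rw [Int.fract, Int.fract, ← e1, ← e2]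
          linarith
        have hi := ih _ _ (Int.fract_nonneg _) hfr (Int.fract_lt_one x⁻¹)
        have hc := inv_two_pow_le hy0 h1
        have hq : (0 : ℝ) < (1 / 2) ^ n := by positivity
        rw [← h, pow_succ]
        nlinarith

lemma questionMark_mono : Monotone questionMark := by
  intro x y hxy
  by_cases h0 : x < 0
  · have := questionMark_mem_unit y
    simpa [questionMark, h0] using this.1
  by_cases h1 : y < 1
  · have ht := tendsto_pow_atTop_nhds_zero_of_lt_one (r := (1 / 2 : ℝ)) (by norm_num)
      (by norm_num)
    have := ge_of_tendsto' ht fun n => questionMark_mono_aux n x y (not_lt.1 h0) hxy h1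
    linarith
  · rw [questionMark_of_one_le (not_lt.1 h1)]
    exact (questionMark_mem_unit x).2

lemma questionMark_inv_add {a : ℕ} (ha : 1 ≤ a) {y : ℝ} (h0 : 0 ≤ y) (h1 : y ≤ 1) :
    questionMark ((a : ℝ) + y)⁻¹ = ((2 : ℝ) ^ a)⁻¹ * (2 - questionMark y) := by
  have ha' : (1 : ℝ) ≤ a := by exact_mod_cast ha
  have key : ∀ (b : ℕ) (z : ℝ), 1 ≤ b → 0 ≤ z → z < 1 → 1 < (b : ℝ) + z →
      questionMark ((b : ℝ) + z)⁻¹ = ((2 : ℝ) ^ b)⁻¹ * (2 - questionMark z) := by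
    intro b z _ hz0 hz1 hbz
    have hfl : ⌊(b : ℝ) + z⌋₊ = b := by
      rw [add_comm, Nat.floor_add_natCast hz0, Nat.floor_eq_zero.2 hz1, zero_add]
    rw [questionMark_rec (by positivity) (inv_lt_one_of_one_lt₀ hbz), inv_inv, hfl,
      Int.fract_natCast_add, Int.fract_eq_self.2 ⟨hz0, hz1⟩]
  rcases h1.lt_or_eq with h1 | rfl
  · rcases (show (1 : ℝ) ≤ (a : ℝ) + y by linarith).lt_or_eq with h | h
    · exact key a y ha h0 h1 h
    · have hy : y = 0 := by linarith
      subst hy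
      have : a = 1 := by
        have : (a : ℝ) = 1 := by linarith
        exact_mod_cast this
      subst this
      rw [questionMark_zero, questionMark_of_one_le (by norm_num)]
      norm_num
  · have := key (a + 1) 0 (by omega) le_rfl one_pos (by push_cast; linarith)
    push_cast at this
    rw [add_zero, questionMark_zero] at this
    rw [this, questionMark_of_one_le le_rfl, pow_succ]
    field_simp
    norm_num

lemma questionMark_dense (n : ℕ) : ∀ v : ℝ, 0 ≤ v → v ≤ 1 →
    ∃ x : ℝ, |questionMark x - v| ≤ (1 / 2) ^ n := by
  suffices ∀ v : ℝ, 0 ≤ v → v ≤ 1 →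
      ∃ x : ℝ, 0 ≤ x ∧ x ≤ 1 ∧ |questionMark x - v| ≤ (1 / 2) ^ n by
    intro v h0 h1
    obtain ⟨x, -, -, h⟩ := this v h0 h1
    exact ⟨x, h⟩
  induction n with
  | zero =>
    intro v h0 h1
    refine ⟨0, le_rfl, zero_le_one, ?_⟩
    rw [questionMark_zero, abs_le]
    norm_num
    constructor <;> linarith
  | succ n ih =>
    intro v h0 h1
    rcases h0.eq_or_lt with rfl | h0
    · refine ⟨0, le_rfl, zero_le_one, ?_⟩
      rw [questionMark_zero, sub_zero, abs_zero]
      positivity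
    · obtain ⟨m, hm1, hm2⟩ := exists_nat_pow_near_of_lt_one h0 h1 (y := (1 / 2 : ℝ))
        (by norm_num) (by norm_num)
      have hp : (0 : ℝ) < 2 ^ (m + 1) := by positivity
      have hpi : ((2 : ℝ) ^ (m + 1))⁻¹ = (1 / 2) ^ (m + 1) := by rw [one_div, inv_pow]
      have hw1 : 1 ≤ 2 ^ (m + 1) * v := by
        rw [← hpi] at hm1
        have := mul_le_mul_of_nonneg_left hm1.le hp.le
        rwa [mul_inv_cancel₀ hp.ne'] at this
      have hw2 : 2 ^ (m + 1) * v ≤ 2 := by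
        have := mul_le_mul_of_nonneg_left hm2 hp.le
        have e : (2 : ℝ) ^ (m + 1) * (1 / 2) ^ m = 2 := by
          rw [one_div, inv_pow, pow_succ]; field_simp
        linarith
      obtain ⟨y, hy0, hy1, hy⟩ := ih (2 - 2 ^ (m + 1) * v) (by linarith) (by linarith)
      have hc : (0 : ℝ) ≤ ((m + 1 : ℕ) : ℝ) := by positivity
      have hb : (1 : ℝ) ≤ ((m + 1 : ℕ) : ℝ) + y := by
        push_cast
        have : (0 : ℝ) ≤ m := by positivity
        linarith
      refine ⟨(((m + 1 : ℕ) : ℝ) + y)⁻¹, by positivity, inv_le_one_of_one_le₀ hb, ?_⟩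
      rw [questionMark_inv_add (by omega) hy0 hy1]
      have e : ((2 : ℝ) ^ (m + 1))⁻¹ * (2 - questionMark y) - v
          = -(((2 : ℝ) ^ (m + 1))⁻¹ * (questionMark y - (2 - 2 ^ (m + 1) * v))) := by
        field_simp
        ring
      rw [e, abs_neg, abs_mul, abs_of_pos (by positivity), hpi, pow_succ (1 / 2 : ℝ) n,
        mul_comm]
      refine mul_le_mul hy ?_ (by positivity) (by positivity)
      rw [pow_succ]
      have : (1 / 2 : ℝ) ^ m ≤ 1 := pow_le_one₀ (by norm_num) (by norm_num)
      linarith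

lemma questionMark_rightCont (x : ℝ) : ContinuousWithinAt questionMark (Set.Ici x) x := by
  rcases (questionMark_mem_unit x).2.lt_or_eq with h | h
  · refine continuousWithinAt_right_of_monotoneOn_of_exists_between
      (s := Set.univ) (questionMark_mono.monotoneOn _) univ_mem fun b hb => ?_
    have hx0 := (questionMark_mem_unit x).1
    set c := min b 1
    have hc : questionMark x < c := lt_min hb h
    have hc1 : c ≤ 1 := min_le_right _ _
    obtain ⟨n, hn⟩ := exists_pow_lt_of_lt_one (y := (1 / 2 : ℝ))
      (show 0 < (c - questionMark x) / 2 by linarith) (by norm_num)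
    obtain ⟨z, hz⟩ := questionMark_dense n ((c + questionMark x) / 2) (by linarith)
      (by linarith)
    have hz' := abs_le.1 hz
    have hcb : c ≤ b := min_le_left _ _
    exact ⟨z, Set.mem_univ _, by linarith, by linarith⟩
  · have : ∀ y ∈ Set.Ici x, questionMark y = 1 := fun y hy =>
      le_antisymm (questionMark_mem_unit y).2 (h ▸ questionMark_mono hy)
    exact (continuousWithinAt_const (b := (1 : ℝ))).congr this h

/-- The question mark function as a (nondecreasing, right-continuous) distribution function. -/
def questionMarkStieltjes : StieltjesFunction ℝ where
  toFun := questionMark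
  mono' := questionMark_mono
  right_continuous' := questionMark_rightCont

/-- The Minkowski question mark measure `μ_?`, whose distribution function is `?`. -/
def minkowskiMeasure : MeasureTheory.Measure ℝ := questionMarkStieltjes.measure

/-! ### Minkowski normality -/

/-- The cylinder set `Δ(d)` of all `y ∈ [0,1)` whose continued fraction expansion starts with the
block `d = d_1, …, d_k`. -/
def cylinder {k : ℕ} (d : Fin k → ℕ) : Set ℝ :=
  {y | y ∈ Set.Ico (0 : ℝ) 1 ∧ ∀ j : Fin k, cfDigit y j = d j}

/-- `blockCount x d n` is `G_n(x, d)`, the number of occurrences of the block `d = d_1, …, d_k`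
(`k ≥ 1`) in the first `n` digits of the continued fraction expansion of `x`. -/
def blockCount (x : ℝ) {k : ℕ} (d : Fin k → ℕ) (n : ℕ) : ℕ :=
  {i ∈ Finset.range n | i + k ≤ n ∧ ∀ j : Fin k, cfDigit x (i + j) = d j}.card

/-- A number `x ∈ [0,1)` is Minkowski normal if every block `d = d_1, …, d_k` of positive integers
occurs in its continued fraction expansion with asymptotic frequency
`μ_?(Δ(d)) = 2^{-(d_1 + ⋯ + d_k)}`. -/
def IsMinkowskiNormal (x : ℝ) : Prop :=
  x ∈ Set.Ico (0 : ℝ) 1 ∧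
    ∀ (k : ℕ) (d : Fin k → ℕ), 1 ≤ k → (∀ j, 1 ≤ d j) →
      Tendsto (fun n : ℕ => (blockCount x d n : ℝ) / n) atTop
          (𝓝 (minkowskiMeasure.real (cylinder d))) ∧
        minkowskiMeasure.real (cylinder d) = ((2 : ℝ) ^ (∑ j, d j))⁻¹

end MinkowskiNormality

end

namespace MinkowskiNormality

/-! ### Infinite continued fractions with positive integer digits -/

/-! On expansions the tree is simple: since `1 / keplerLeft q = 1 + 1 / q` and `1 / keplerRight q =
1 + q`, the left child increases the first digit by one and the right child puts a `1` in front.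
Level `l` is therefore the list of words `descendants l [2]`.

Fix a block `d` of sum `s`. Among the two children of a word, exactly one starts with `1 :: d` if
the word starts with `d`, and none otherwise; likewise for `(h + 1) :: d` and `h :: d`. Reading `d`
back through `s` levels uses it up, so from depth `s` on exactly the proportion `2 ^ (-s)` of the
words start with `d` (`descSum_prefixInd`). Occurrences away from the start of a word pass to both
children, and one at the start becomes interior in the right child only. Hence the summed interior
discrepancy doubles at each level, up to an error that vanishes from depth `s` on, and a level of `2
^ m` words has discrepancy `O(2 ^ m)`, seams between words included.

Cutting a level at an arbitrary place leaves complete subtrees along one path of the tree, whose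
errors add up geometrically to `O(2 ^ m)` again (`abs_discrepancy_prefix_descendants_le`). But the
first `L` levels have `L * 2 ^ (L - 1)` digits, so the relative error is `O(1 / L)`.

The rest is the dictionary between digits and numbers: positive digits define a convergent continued
fraction with those digits, and the question mark function, being continuous, gives a cylinder the
mass `2 ^ (-s)`. -/

/-- The finite continued fraction `[a_0, …, a_{n-1}]`, evaluated from the right. -/
noncomputable def cfEval : (ℕ → ℕ) → ℕ → ℝ
  | _, 0 => 0
  | a, n + 1 => ((a 0 : ℝ) + cfEval (fun i => a (i + 1)) n)⁻¹

lemma cfEval_nonneg (n : ℕ) : ∀ a : ℕ → ℕ, 0 ≤ cfEval a n := by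
  induction n with
  | zero => intro a; exact le_rfl
  | succ n ih => intro a; have := ih (fun i => a (i + 1)); simp only [cfEval]; positivity

lemma cfEval_le_one {a : ℕ → ℕ} (ha : ∀ i, 1 ≤ a i) (n : ℕ) : cfEval a n ≤ 1 := by
  cases n with
  | zero => exact zero_le_one
  | succ n =>
    have h0 : (1 : ℝ) ≤ a 0 := by exact_mod_cast ha 0
    have := cfEval_nonneg n (fun i => a (i + 1))
    exact inv_le_one_of_one_le₀ (by linarith)

/-- One step `x ↦ 1 / (a + x)` need not contract strictly when `a = 1`. Two steps form a Möbius map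
of determinant `1` with denominator at least `2`, which gives the factor `1 / 4`. -/
lemma abs_inv_add_inv_sub_le {a b x y : ℝ} (ha : 1 ≤ a) (hb : 1 ≤ b) (hx : 0 ≤ x)
    (hy : 0 ≤ y) : |(a + (b + x)⁻¹)⁻¹ - (a + (b + y)⁻¹)⁻¹| ≤ 1 / 4 * |x - y| := by
  have hX : 2 ≤ a * (b + x) + 1 := by nlinarith
  have hY : 2 ≤ a * (b + y) + 1 := by nlinarith
  have hx' : 0 < b + x := by linarith
  have hy' : 0 < b + y := by linarith
  have e : (a + (b + x)⁻¹)⁻¹ - (a + (b + y)⁻¹)⁻¹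
      = ((a * (b + x) + 1) * (a * (b + y) + 1))⁻¹ * (x - y) := by
    have e1 : a + (b + x)⁻¹ = (a * (b + x) + 1) / (b + x) := by field_simp
    have e2 : a + (b + y)⁻¹ = (a * (b + y) + 1) / (b + y) := by field_simp
    rw [e1, e2, inv_div, inv_div]
    field_simp
    ring
  rw [e, abs_mul, abs_of_pos (by positivity)]
  refine mul_le_mul_of_nonneg_right ?_ (abs_nonneg _)
  rw [one_div]
  exact inv_anti₀ (by norm_num) (by nlinarith)

lemma abs_cfEval_sub_le (k : ℕ) : ∀ {a : ℕ → ℕ}, (∀ i, 1 ≤ a i) → ∀ {n m : ℕ},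
    2 * k ≤ n → 2 * k ≤ m → |cfEval a n - cfEval a m| ≤ (1 / 4) ^ k := by
  induction k with
  | zero =>
    intro a ha n m _ _
    have := cfEval_nonneg n a
    have := cfEval_nonneg m a
    have := cfEval_le_one ha n
    have := cfEval_le_one ha m
    rw [pow_zero, abs_le]
    constructor <;> linarith
  | succ k ih =>
    intro a ha n m hn hm
    obtain ⟨n, rfl⟩ : ∃ n', n = n' + 2 := ⟨n - 2, by omega⟩
    obtain ⟨m, rfl⟩ : ∃ m', m = m' + 2 := ⟨m - 2, by omega⟩
    have h0 : (1 : ℝ) ≤ a 0 := by exact_mod_cast ha 0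
    have h1 : (1 : ℝ) ≤ a 1 := by exact_mod_cast ha 1
    have := ih (a := fun i => a (i + 1 + 1)) (fun i => ha _) (n := n) (m := m) (by omega) (by omega)
    calc _ ≤ 1 / 4 * |cfEval (fun i => a (i + 1 + 1)) n - cfEval (fun i => a (i + 1 + 1)) m| :=
          abs_inv_add_inv_sub_le h0 h1 (cfEval_nonneg _ _) (cfEval_nonneg _ _)
      _ ≤ _ := by rw [pow_succ]; linarith

lemma exists_tendsto_cfEval {a : ℕ → ℕ} (ha : ∀ i, 1 ≤ a i) :
    ∃ x, Tendsto (cfEval a) atTop (𝓝 x) := by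
  refine cauchySeq_tendsto_of_complete (Metric.cauchySeq_iff'.2 fun ε hε => ?_)
  obtain ⟨k, hk⟩ := exists_pow_lt_of_lt_one hε (y := (1 / 4 : ℝ)) (by norm_num)
  exact ⟨2 * k, fun n hn => (abs_cfEval_sub_le k ha hn le_rfl).trans_lt hk⟩

/-- The value of the infinite continued fraction `[a_0, a_1, …]`. -/
noncomputable def cfValue (a : ℕ → ℕ) : ℝ := limUnder atTop (cfEval a)

lemma tendsto_cfEval {a : ℕ → ℕ} (ha : ∀ i, 1 ≤ a i) :
    Tendsto (cfEval a) atTop (𝓝 (cfValue a)) :=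
  tendsto_nhds_limUnder (exists_tendsto_cfEval ha)

lemma cfValue_nonneg {a : ℕ → ℕ} (ha : ∀ i, 1 ≤ a i) : 0 ≤ cfValue a :=
  ge_of_tendsto' (tendsto_cfEval ha) fun n => cfEval_nonneg n a

lemma cfValue_eq {a : ℕ → ℕ} (ha : ∀ i, 1 ≤ a i) :
    cfValue a = ((a 0 : ℝ) + cfValue fun i => a (i + 1))⁻¹ := by
  have h0 : (1 : ℝ) ≤ a 0 := by exact_mod_cast ha 0
  have hs := cfValue_nonneg (a := fun i => a (i + 1)) fun i => ha _
  have h1 := (tendsto_cfEval (a := fun i => a (i + 1)) fun i => ha _).const_add (a 0 : ℝ)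
  exact tendsto_nhds_unique ((tendsto_add_atTop_iff_nat 1).2 (tendsto_cfEval ha))
    (h1.inv₀ (by positivity))

lemma cfValue_pos {a : ℕ → ℕ} (ha : ∀ i, 1 ≤ a i) : 0 < cfValue a := by
  have h0 : (1 : ℝ) ≤ a 0 := by exact_mod_cast ha 0
  have hs := cfValue_nonneg (a := fun i => a (i + 1)) fun i => ha _
  rw [cfValue_eq ha]
  positivity

lemma cfValue_lt_one {a : ℕ → ℕ} (ha : ∀ i, 1 ≤ a i) : cfValue a < 1 := by
  have h0 : (1 : ℝ) ≤ a 0 := by exact_mod_cast ha 0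
  have hs := cfValue_pos (a := fun i => a (i + 1)) fun i => ha _
  rw [cfValue_eq ha]
  exact inv_lt_one_of_one_lt₀ (by linarith)

lemma cfDigit_zero_inv_add {b : ℕ} (hb : 1 ≤ b) {t : ℝ} (h0 : 0 < t) (h1 : t < 1) :
    cfDigit ((b : ℝ) + t)⁻¹ 0 = b := by
  have hb' : (1 : ℝ) ≤ b := by exact_mod_cast hb
  rw [cfDigit_zero_right (by positivity) (inv_lt_one_of_one_lt₀ (by linarith)), inv_inv, add_comm,
    Nat.floor_add_natCast h0.le, Nat.floor_eq_zero.2 h1, zero_add]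

lemma cfDigit_succ_inv_add {b : ℕ} (hb : 1 ≤ b) {t : ℝ} (h0 : 0 < t) (h1 : t < 1) (n : ℕ) :
    cfDigit ((b : ℝ) + t)⁻¹ (n + 1) = cfDigit t n := by
  have hb' : (1 : ℝ) ≤ b := by exact_mod_cast hb
  rw [cfDigit_succ (by positivity) (inv_lt_one_of_one_lt₀ (by linarith)), inv_inv,
    Int.fract_natCast_add, Int.fract_eq_self.2 ⟨h0.le, h1⟩]

lemma cfDigit_cfValue (n : ℕ) : ∀ {a : ℕ → ℕ}, (∀ i, 1 ≤ a i) → cfDigit (cfValue a) n = a n := by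
  induction n with
  | zero =>
    intro a ha
    rw [cfValue_eq ha]
    exact cfDigit_zero_inv_add (ha 0) (cfValue_pos fun i => ha _) (cfValue_lt_one fun i => ha _)
  | succ n ih =>
    intro a ha
    rw [cfValue_eq ha, cfDigit_succ_inv_add (ha 0) (cfValue_pos fun i => ha _)
      (cfValue_lt_one fun i => ha _)]
    exact ih (a := fun i => a (i + 1)) fun i => ha _

/-- The expansion of a rational terminates, and beyond its end `cfDigit` takes the default value
`0`. -/
lemma irrational_of_cfDigit_pos {x : ℝ} (hx : ∀ n, 1 ≤ cfDigit x n) : Irrational x := by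
  rintro ⟨q, rfl⟩
  obtain ⟨n, hn⟩ := (GenContFract.terminates_iff_rat (q : ℝ)).2 ⟨q, rfl⟩
  have h : (GenContFract.of (q : ℝ)).s.get? n = none := hn
  have := hx n
  simp [cfDigit, GenContFract.partDens, Stream'.Seq.map_get?, h] at this

/-- The infinite continued fraction with integer part `0` and digits `a`. -/
noncomputable def natContFract (a : ℕ → ℕ) : GenContFract ℝ where
  h := 0
  s := Stream'.Seq.ofStream fun n => ⟨1, (a n : ℝ)⟩

lemma natContFract_s_get? (a : ℕ → ℕ) (n : ℕ) :
    (natContFract a).s.get? n = some ⟨1, (a n : ℝ)⟩ := rfl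

lemma natContFract_s_tail (a : ℕ → ℕ) :
    (natContFract a).s.tail = (natContFract fun i => a (i + 1)).s := by
  ext1 n
  rw [Stream'.Seq.get?_tail]
  rfl

lemma convs'Aux_natContFract (n : ℕ) : ∀ a : ℕ → ℕ,
    GenContFract.convs'Aux (natContFract a).s n = cfEval a n := by
  induction n with
  | zero => intro a; rfl
  | succ n ih =>
    intro a
    rw [GenContFract.convs'Aux_succ_some (natContFract_s_get? a 0), natContFract_s_tail, ih,
      one_div]
    rfl

/-- The three-term recurrence and the evaluation from the right agree because all entries are
positive. -/
lemma natContFract_convs {a : ℕ → ℕ} (ha : ∀ i, 1 ≤ a i) :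
    (natContFract a).convs = cfEval a := by
  funext n
  refine (GenContFract.convs_eq_convs' ?_).trans ((zero_add _).trans (convs'Aux_natContFract n a))
  · intro gp m _ h
    rw [natContFract_s_get?, Option.some.injEq] at h
    subst h
    exact ⟨one_pos, Nat.cast_pos.2 (ha m)⟩

/-! ### Continued fraction expansions along the Kepler tree -/

/-- Increase the first entry of a list by one. -/
def incrHead : List ℕ → List ℕ
  | [] => []
  | a :: w => (a + 1) :: w

lemma of_s_congr {u v : ℚ} (h : Int.fract u = Int.fract v) :
    (GenContFract.of u).s = (GenContFract.of v).s := by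
  ext1 n
  cases n with
  | zero =>
    by_cases h0 : Int.fract u = 0
    · obtain ⟨a, rfl⟩ : ∃ a : ℤ, u = a := ⟨⌊u⌋, eq_of_sub_eq_zero h0⟩
      obtain ⟨b, rfl⟩ : ∃ b : ℤ, v = b := ⟨⌊v⌋, eq_of_sub_eq_zero (h.symm.trans h0)⟩
      rw [GenContFract.of_s_of_int, GenContFract.of_s_of_int]
    · have e1 := GenContFract.of_s_head (v := u) h0
      have e2 := GenContFract.of_s_head (v := v) (h ▸ h0)
      rw [← h] at e2
      exact e1.trans e2.symm
  | succ n => rw [GenContFract.of_s_succ, GenContFract.of_s_succ, h]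

lemma getElem?_cfList (q : ℚ) (n : ℕ) :
    (cfList q)[n]? = ((GenContFract.of q).s.get? n).map fun p => ⌊p.b⌋₊ := by
  rw [cfList, List.getElem?_map]
  exact congrArg _ (Stream'.Seq.getElem?_toList _ _ n)

lemma cfList_congr {u v : ℚ} (h : Int.fract u = Int.fract v) : cfList u = cfList v := by
  apply List.ext_getElem?
  intro n
  rw [getElem?_cfList, getElem?_cfList, of_s_congr h]

/-- The argument `q⁻¹` lies outside `[0,1)`, which is harmless: `cfList` ignores the integer part.
-/
lemma cfList_eq_cons {q : ℚ} (h0 : 0 < q) (h1 : q < 1) :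
    cfList q = ⌊q⁻¹⌋₊ :: cfList q⁻¹ := by
  have hf : Int.fract q = q := Int.fract_eq_self.2 ⟨h0.le, h1⟩
  apply List.ext_getElem?
  intro n
  cases n with
  | zero =>
    have h := GenContFract.of_s_head (v := q) (by rw [hf]; exact h0.ne')
    rw [hf] at h
    change (GenContFract.of q).s.get? 0 = _ at h
    have hn : (⌊q⁻¹⌋₊ : ℤ) = ⌊q⁻¹⌋ := Int.natCast_floor_eq_floor (by positivity)
    rw [getElem?_cfList, h]
    simp [← hn]
  | succ n => rw [List.getElem?_cons_succ, getElem?_cfList, getElem?_cfList,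
      GenContFract.of_s_succ, hf]

lemma cfList_one_half : cfList (1 / 2) = [2] := by
  have h : cfList ((2 : ℤ) : ℚ) = [] := by
    apply List.ext_getElem?
    intro n
    rw [getElem?_cfList, GenContFract.of_s_of_int]
    simp
  rw [cfList_eq_cons (by norm_num) (by norm_num), one_div, inv_inv]
  rw [Int.cast_ofNat] at h
  rw [h]
  norm_num

lemma keplerLeft_eq {q : ℚ} (h0 : 0 < q) : keplerLeft q = (1 + q⁻¹)⁻¹ := by
  have hn : (0 : ℚ) < q.num := by exact_mod_cast Rat.num_pos.2 h0
  have hd : (0 : ℚ) < q.den := by exact_mod_cast q.den_pos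
  have e : q = q.num / q.den := (Rat.num_div_den q).symm
  rw [keplerLeft]
  conv_rhs => rw [e]
  field_simp

lemma keplerRight_eq {q : ℚ} (h0 : 0 < q) : keplerRight q = (1 + q)⁻¹ := by
  have hn : (0 : ℚ) < q.num := by exact_mod_cast Rat.num_pos.2 h0
  have hd : (0 : ℚ) < q.den := by exact_mod_cast q.den_pos
  have e : q = q.num / q.den := (Rat.num_div_den q).symm
  rw [keplerRight]
  conv_rhs => rw [e]
  field_simp
  ring

lemma keplerLeft_mem {q : ℚ} (h0 : 0 < q) : 0 < keplerLeft q ∧ keplerLeft q < 1 := by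
  rw [keplerLeft_eq h0]
  have : 0 < q⁻¹ := inv_pos.2 h0
  exact ⟨by positivity, inv_lt_one_of_one_lt₀ (by linarith)⟩

lemma keplerRight_mem {q : ℚ} (h0 : 0 < q) : 0 < keplerRight q ∧ keplerRight q < 1 := by
  rw [keplerRight_eq h0]
  exact ⟨by positivity, inv_lt_one_of_one_lt₀ (by linarith)⟩

lemma cfList_keplerLeft {q : ℚ} (h0 : 0 < q) (h1 : q < 1) :
    cfList (keplerLeft q) = incrHead (cfList q) := by
  obtain ⟨h2, h3⟩ := keplerLeft_mem h0
  have hi : 0 ≤ q⁻¹ := inv_nonneg.2 h0.le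
  rw [cfList_eq_cons h2 h3, cfList_eq_cons h0 h1, incrHead, keplerLeft_eq h0, inv_inv, add_comm,
    Nat.floor_add_one hi, cfList_congr (Int.fract_add_one _)]

lemma cfList_keplerRight {q : ℚ} (h0 : 0 < q) (h1 : q < 1) :
    cfList (keplerRight q) = 1 :: cfList q := by
  obtain ⟨h2, h3⟩ := keplerRight_mem h0
  rw [cfList_eq_cons h2 h3, keplerRight_eq h0, inv_inv, add_comm,
    Nat.floor_add_one h0.le, cfList_congr (Int.fract_add_one _), Nat.floor_eq_zero.2 h1]

lemma keplerLevel_mem (l : ℕ) : ∀ q ∈ keplerLevel l, 0 < q ∧ q < 1 := by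
  induction l with
  | zero => simp [keplerLevel]; norm_num
  | succ l ih =>
    intro q hq
    simp only [keplerLevel, List.mem_flatMap, List.mem_cons, List.not_mem_nil, or_false] at hq
    obtain ⟨p, hp, rfl | rfl⟩ := hq
    · exact keplerLeft_mem (ih p hp).1
    · exact keplerRight_mem (ih p hp).1

/-! ### The measure of cylinders -/

/-- A monotone function whose values are dense in `[0,1]` has no jumps. With right continuity this
makes the measure atomless. -/
lemma questionMark_leftCont (x : ℝ) : ContinuousWithinAt questionMark (Set.Iic x) x := by
  rcases (questionMark_mem_unit x).1.lt_or_eq with h | h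
  · refine continuousWithinAt_left_of_monotoneOn_of_exists_between
      (s := Set.univ) (questionMark_mono.monotoneOn _) univ_mem fun b hb => ?_
    have hx1 := (questionMark_mem_unit x).2
    -- The truncation keeps the target value in `[0,1]`, where `questionMark_dense` applies.
    set c := max b 0
    have hc : c < questionMark x := max_lt hb h
    have hc0 : 0 ≤ c := le_max_right _ _
    obtain ⟨n, hn⟩ := exists_pow_lt_of_lt_one (y := (1 / 2 : ℝ))
      (show 0 < (questionMark x - c) / 2 by linarith) (by norm_num)
    obtain ⟨z, hz⟩ := questionMark_dense n ((c + questionMark x) / 2) (by linarith)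
      (by linarith)
    have hz' := abs_le.1 hz
    have hcb : b ≤ c := le_max_left _ _
    exact ⟨z, Set.mem_univ _, by linarith, by linarith⟩
  · have : ∀ y ∈ Set.Iic x, questionMark y = 0 := fun y hy =>
      le_antisymm (h ▸ questionMark_mono hy) (questionMark_mem_unit y).1
    exact (continuousWithinAt_const (b := (0 : ℝ))).congr this h.symm

lemma leftLim_questionMark (x : ℝ) : Function.leftLim questionMark x = questionMark x :=
  (questionMark_leftCont x).leftLim_eq

lemma minkowskiMeasure_Icc (a b : ℝ) :
    minkowskiMeasure (Set.Icc a b) = ENNReal.ofReal (questionMark b - questionMark a) := by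
  have h := questionMarkStieltjes.measure_Icc a b
  have e : Function.leftLim questionMarkStieltjes a = questionMark a := leftLim_questionMark a
  rw [e] at h
  exact h

lemma minkowskiMeasure_Ioo (a b : ℝ) :
    minkowskiMeasure (Set.Ioo a b) = ENNReal.ofReal (questionMark b - questionMark a) := by
  have h := questionMarkStieltjes.measure_Ioo (a := a) (b := b)
  have e : Function.leftLim questionMarkStieltjes b = questionMark b := leftLim_questionMark b
  rw [e] at h
  exact h

/-- Which endpoints belong to a cylinder varies with the block, so it is only squeezed between an
open and a closed interval; these have equal mass. Prepending a digit `b` applies `y ↦ 1 / (b + y)`,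
which swaps the endpoints and multiplies increments of the question mark function by `-2 ^ (-b)`. -/
lemma cylinder_between (k : ℕ) : ∀ d : Fin k → ℕ, (∀ j, 1 ≤ d j) →
    ∃ lo hi : ℝ, 0 ≤ lo ∧ lo < hi ∧ hi ≤ 1 ∧ Set.Ioo lo hi ⊆ cylinder d ∧
      cylinder d ⊆ Set.Icc lo hi ∧
      questionMark hi - questionMark lo = ((2 : ℝ) ^ (∑ j, d j))⁻¹ := by
  induction k with
  | zero =>
    intro d _
    refine ⟨0, 1, le_rfl, one_pos, le_rfl, fun y hy => ⟨⟨hy.1.le, hy.2⟩, fun j => j.elim0⟩,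
      fun y hy => ⟨hy.1.1, hy.1.2.le⟩, ?_⟩
    rw [questionMark_zero, questionMark_of_one_le le_rfl]
    simp
  | succ k ih =>
    intro d hd
    obtain ⟨lo, hi, h0, hlt, h1, hsub, hsup, hq⟩ := ih (fun j => d j.succ) fun j => hd _
    have hb := hd 0
    have hb' : (1 : ℝ) ≤ d 0 := by exact_mod_cast hb
    refine ⟨((d 0 : ℝ) + hi)⁻¹, ((d 0 : ℝ) + lo)⁻¹, inv_nonneg.2 (by linarith),
      inv_strictAnti₀ (by linarith) (by linarith), inv_le_one_of_one_le₀ (by linarith), ?_, ?_, ?_⟩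
    · rintro y ⟨hy1, hy2⟩
      have hy0 : 0 < y := (inv_pos.2 (by linarith)).trans hy1
      have e1 : y⁻¹ < d 0 + hi := inv_lt_of_inv_lt₀ (by linarith) hy1
      have e2 : d 0 + lo < y⁻¹ := (lt_inv_comm₀ (by linarith) hy0).2 hy2
      obtain ⟨t, ht⟩ : ∃ t, y⁻¹ = d 0 + t := ⟨y⁻¹ - d 0, by ring⟩
      have ht0 : lo < t := by linarith
      have ht1 : t < hi := by linarith
      have hy : y = ((d 0 : ℝ) + t)⁻¹ := by rw [← ht, inv_inv]
      have hc := hsub ⟨ht0, ht1⟩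
      refine ⟨⟨hy0.le, hy ▸ inv_lt_one_of_one_lt₀ (by linarith)⟩, fun j => ?_⟩
      rw [hy]
      refine Fin.cases ?_ (fun j => ?_) j
      · exact cfDigit_zero_inv_add hb (by linarith) (by linarith)
      · rw [Fin.val_succ, cfDigit_succ_inv_add hb (by linarith) (by linarith)]
        exact hc.2 j
    · rintro y ⟨⟨hy0, hy1⟩, hy⟩
      have hd0 := hy 0
      rcases hy0.eq_or_lt with rfl | hy0
      · rw [cfDigit_zero_left] at hd0; omega
      have hfl : ⌊y⁻¹⌋₊ = d 0 := by rw [← hd0]; exact (cfDigit_zero_right hy0 hy1).symm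
      have hm := hsup (a := Int.fract y⁻¹) ⟨⟨Int.fract_nonneg _, Int.fract_lt_one _⟩, fun j => by
        rw [← cfDigit_succ hy0 hy1]; exact hy j.succ⟩
      have e : y = ((d 0 : ℝ) + Int.fract y⁻¹)⁻¹ := by
        rw [← hfl, natCast_floor_eq_intCast_floor (by positivity), Int.floor_add_fract, inv_inv]
      have hf := Int.fract_nonneg y⁻¹
      rw [e]
      exact ⟨inv_anti₀ (by linarith) (by linarith [hm.2]),
        inv_anti₀ (by linarith) (by linarith [hm.1])⟩
    · rw [questionMark_inv_add hb h0 (by linarith), questionMark_inv_add hb (by linarith) h1,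
        Fin.sum_univ_succ, pow_add, mul_inv, ← hq]
      ring

lemma minkowskiMeasure_real_cylinder {k : ℕ} {d : Fin k → ℕ} (hd : ∀ j, 1 ≤ d j) :
    minkowskiMeasure.real (cylinder d) = ((2 : ℝ) ^ (∑ j, d j))⁻¹ := by
  obtain ⟨lo, hi, -, -, -, hsub, hsup, hq⟩ := cylinder_between k d hd
  have h : minkowskiMeasure (cylinder d) = ENNReal.ofReal ((2 : ℝ) ^ (∑ j, d j))⁻¹ := by
    rw [← hq]
    exact le_antisymm (minkowskiMeasure_Icc lo hi ▸ MeasureTheory.measure_mono hsup)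
      (minkowskiMeasure_Ioo lo hi ▸ MeasureTheory.measure_mono hsub)
  rw [MeasureTheory.measureReal_def, h, ENNReal.toReal_ofReal (by positivity)]

/-! ### Occurrences of a block in a list -/

/-- The number of occurrences of the block `d` in a list. -/
def occ (d : List ℕ) : List ℕ → ℕ
  | [] => 0
  | a :: w => (if d <+: a :: w then 1 else 0) + occ d w

lemma occ_le_length (d w : List ℕ) : occ d w ≤ w.length := by
  induction w with
  | nil => exact le_rfl
  | cons a w ih => rw [occ, List.length_cons]; split_ifs <;> omega

lemma occ_add_occ_le (d v w : List ℕ) : occ d v + occ d w ≤ occ d (v ++ w) := by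
  induction v with
  | nil => simp [occ]
  | cons a v ih =>
    rw [List.cons_append, occ, occ]
    have : d <+: a :: v → d <+: a :: (v ++ w) := fun h => h.trans (List.prefix_append (a :: v) w)
    split_ifs <;> first | omega | tauto

/-- Only occurrences straddling the seam are new, and they start in the last `d.length` places of
`v`. The minimum with `v.length` lets the induction absorb one such start per letter while `v` is
shorter than `d`. -/
lemma occ_append_le (d v w : List ℕ) :
    occ d (v ++ w) ≤ occ d v + occ d w + min v.length d.length := by
  induction v with
  | nil => simp [occ]
  | cons a v ih =>
    rw [List.cons_append, occ, occ, List.length_cons]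
    by_cases hl : d.length ≤ v.length + 1
    · have : d <+: a :: (v ++ w) → d <+: a :: v := fun h =>
        List.prefix_of_prefix_length_le h (List.prefix_append (a :: v) w) hl
      split_ifs <;> first | omega | tauto
    · split_ifs <;> omega

/-- The expected frequency `2^{-(d_1 + ⋯ + d_k)}` of the block `d`. -/
noncomputable def blockFreq (d : List ℕ) : ℝ := ((2 : ℝ) ^ d.sum)⁻¹

lemma blockFreq_pos (d : List ℕ) : 0 < blockFreq d := by unfold blockFreq; positivity

lemma blockFreq_le_one (d : List ℕ) : blockFreq d ≤ 1 :=
  inv_le_one_of_one_le₀ (one_le_pow₀ one_le_two)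

/-- The deviation of the number of occurrences of `d` from its expected value. -/
noncomputable def discrepancy (d w : List ℕ) : ℝ := occ d w - blockFreq d * w.length

lemma abs_discrepancy_le (d w : List ℕ) : |discrepancy d w| ≤ w.length := by
  have h1 : (occ d w : ℝ) ≤ w.length := by exact_mod_cast occ_le_length d w
  have h2 : (0 : ℝ) ≤ w.length := Nat.cast_nonneg _
  have h3 : (0 : ℝ) ≤ occ d w := Nat.cast_nonneg _
  have h4 := mul_le_of_le_one_left h2 (blockFreq_le_one d)
  have h5 := mul_nonneg (blockFreq_pos d).le h2
  rw [discrepancy, abs_le]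
  constructor <;> linarith

lemma abs_discrepancy_append_sub_le (d v w : List ℕ) :
    |discrepancy d (v ++ w) - (discrepancy d v + discrepancy d w)| ≤ d.length := by
  have h1 : (occ d v : ℝ) + occ d w ≤ occ d (v ++ w) := by exact_mod_cast occ_add_occ_le d v w
  have h2 : (occ d (v ++ w) : ℝ) ≤ occ d v + occ d w + d.length := by
    exact_mod_cast (occ_append_le d v w).trans (by omega)
  simp only [discrepancy, List.length_append]
  push_cast
  rw [abs_le]
  constructor <;> linarith

lemma abs_discrepancy_append_le (d v w : List ℕ) :
    |discrepancy d (v ++ w)| ≤ |discrepancy d v| + |discrepancy d w| + d.length := by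
  have h := abs_discrepancy_append_sub_le d v w
  have h1 := abs_add_le (discrepancy d v) (discrepancy d w)
  have h2 := abs_sub_abs_le_abs_sub (discrepancy d (v ++ w)) (discrepancy d v + discrepancy d w)
  linarith

lemma abs_discrepancy_flatten_sub_le (d : List ℕ) (W : List (List ℕ)) :
    |discrepancy d W.flatten - (W.map (discrepancy d)).sum| ≤ d.length * W.length := by
  induction W with
  | nil => simp [discrepancy, occ]
  | cons w W ih =>
    have h := abs_discrepancy_append_sub_le d w W.flatten
    rw [abs_le] at *
    simp only [List.flatten_cons, List.map_cons, List.sum_cons, List.length_cons]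
    push_cast
    constructor <;> linarith

/-! ### Words obtained along the Kepler tree -/

/-- The words at depth `m` below `w` in the binary tree in which the children of `v` are obtained
by increasing the first entry of `v` and by putting `1` in front of `v`. -/
def descendants : ℕ → List ℕ → List (List ℕ)
  | 0, w => [w]
  | m + 1, w => descendants m (incrHead w) ++ descendants m (1 :: w)

/-- The definition branches at the root, which suits cutting a level into subtrees; this form
branches at the leaves, which suits recursion from level to level. -/
lemma descendants_succ (m : ℕ) : ∀ w,
    descendants (m + 1) w = (descendants m w).flatMap fun v => [incrHead v, 1 :: v] := by
  induction m with
  | zero => intro w; rfl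
  | succ m ih =>
    intro w
    rw [descendants, ih, ih, ← List.flatMap_append]
    rfl

lemma length_descendants (m : ℕ) : ∀ w, (descendants m w).length = 2 ^ m := by
  induction m with
  | zero => intro w; rfl
  | succ m ih => intro w; rw [descendants, List.length_append, ih, ih]; ring

lemma length_incrHead (w : List ℕ) : (incrHead w).length = w.length := by cases w <;> rfl

lemma pos_of_mem_descendants (m : ℕ) : ∀ {w : List ℕ}, (∀ a ∈ w, 1 ≤ a) →
    ∀ v ∈ descendants m w, ∀ a ∈ v, 1 ≤ a := by
  induction m with
  | zero => intro w hw v hv; rw [descendants, List.mem_singleton] at hv; exact hv ▸ hw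
  | succ m ih =>
    intro w hw v hv
    rw [descendants, List.mem_append] at hv
    refine hv.elim (ih ?_ v) (ih ?_ v)
    · cases w with
      | nil => exact hw
      | cons b w =>
        intro a ha
        rw [incrHead, List.mem_cons] at ha
        rcases ha with rfl | ha
        · omega
        · exact hw a (List.mem_cons_of_mem _ ha)
    · intro a ha
      rw [List.mem_cons] at ha
      rcases ha with rfl | ha
      · exact le_rfl
      · exact hw a ha

lemma map_cfList_keplerLevel (l : ℕ) : (keplerLevel l).map cfList = descendants l [2] := by
  induction l with
  | zero => simp [keplerLevel, descendants, ← cfList_one_half]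
  | succ l ih =>
    rw [descendants_succ, ← ih, keplerLevel, List.map_flatMap, List.flatMap_map]
    refine List.flatMap_congr fun q hq => ?_
    obtain ⟨h0, h1⟩ := keplerLevel_mem l q hq
    simp [cfList_keplerLeft h0 h1, cfList_keplerRight h0 h1]

/-- The sum of `f` over the words at depth `m` below `w`. -/
noncomputable def descSum (f : List ℕ → ℝ) (m : ℕ) (w : List ℕ) : ℝ :=
  ((descendants m w).map f).sum

/-- Descending one level amounts to replacing `f` by its sum over the two children. -/
lemma descSum_succ (f : List ℕ → ℝ) (m : ℕ) (w : List ℕ) :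
    descSum f (m + 1) w = descSum (fun v => f (incrHead v) + f (1 :: v)) m w := by
  rw [descSum, descSum, descendants_succ]
  induction descendants m w with
  | nil => rfl
  | cons v W ih =>
    simp only [List.flatMap_cons, List.map_append, List.sum_append, List.map_cons, List.sum_cons,
      List.map_nil, List.sum_nil] at ih ⊢
    rw [ih]
    ring

lemma descSum_add (f g : List ℕ → ℝ) (m : ℕ) (w : List ℕ) :
    descSum (fun v => f v + g v) m w = descSum f m w + descSum g m w := List.sum_map_add

lemma descSum_const_mul (c : ℝ) (f : List ℕ → ℝ) (m : ℕ) (w : List ℕ) :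
    descSum (fun v => c * f v) m w = c * descSum f m w := List.sum_map_mul_left ..

lemma descSum_const (c : ℝ) (m : ℕ) (w : List ℕ) :
    descSum (fun _ => c) m w = 2 ^ m * c := by
  simp [descSum, length_descendants]

lemma descSum_congr {f g : List ℕ → ℝ} {m : ℕ} {w : List ℕ} (hw : ∀ a ∈ w, 1 ≤ a)
    (h : ∀ v, (∀ a ∈ v, 1 ≤ a) → f v = g v) : descSum f m w = descSum g m w := by
  unfold descSum
  rw [List.map_congr_left fun v hv => h v (pos_of_mem_descendants m hw v hv)]

lemma descSum_mono {f g : List ℕ → ℝ} {m : ℕ} {w : List ℕ} (h : ∀ v, f v ≤ g v) :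
    descSum f m w ≤ descSum g m w := List.sum_le_sum fun v _ => h v

/-- The indicator function of the words starting with `d`. -/
noncomputable def prefixInd (d v : List ℕ) : ℝ := if d <+: v then 1 else 0

/-- Positivity makes the first entry of a nonempty `incrHead v` at least `2`, so only the right
child can start with `1`. -/
lemma prefixInd_one_cons (d v : List ℕ) (hv : ∀ a ∈ v, 1 ≤ a) :
    prefixInd (1 :: d) (incrHead v) + prefixInd (1 :: d) (1 :: v) = prefixInd d v := by
  cases v with
  | nil => simp [prefixInd, incrHead]
  | cons a v =>
    have : a ≠ 0 := by have := hv a List.mem_cons_self; omega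
    simp [prefixInd, incrHead, List.cons_prefix_cons, this]

lemma prefixInd_succ_cons {h : ℕ} (hh : 1 ≤ h) (d v : List ℕ) :
    prefixInd ((h + 1) :: d) (incrHead v) + prefixInd ((h + 1) :: d) (1 :: v)
      = prefixInd (h :: d) v := by
  have : h ≠ 0 := by omega
  cases v with
  | nil => simp [prefixInd, incrHead, List.cons_prefix_cons, this]
  | cons a v => simp [prefixInd, incrHead, List.cons_prefix_cons, this]

/-- Each level upward removes one unit from the block, so after `d.sum` levels the empty block
remains, a prefix of all `2 ^ m` words at depth `m`. -/
lemma descSum_prefixInd {d : List ℕ} (hd : ∀ a ∈ d, 1 ≤ a) : ∀ (m : ℕ) {w : List ℕ},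
    (∀ a ∈ w, 1 ≤ a) → descSum (prefixInd d) (m + d.sum) w = 2 ^ m := by
  induction d with
  | nil =>
    intro m w _
    have : prefixInd [] = fun _ => (1 : ℝ) := by funext v; simp [prefixInd]
    rw [this, descSum_const]
    simp
  | cons h d ih =>
    have hh : 1 ≤ h := hd h List.mem_cons_self
    have ih' := ih fun a ha => hd a (List.mem_cons_of_mem _ ha)
    clear hd ih
    induction h, hh using Nat.le_induction with
    | base =>
      intro m w hw
      rw [List.sum_cons, add_comm 1, ← add_assoc, descSum_succ,
        descSum_congr hw (prefixInd_one_cons d), ih' m hw]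
    | succ h hh ihh =>
      intro m w hw
      rw [List.sum_cons, add_right_comm, ← add_assoc, descSum_succ,
        descSum_congr hw fun v _ => prefixInd_succ_cons hh d v, ← ihh m hw, List.sum_cons]

lemma abs_descSum_prefixInd_sub_le (d : List ℕ) (m : ℕ) (w : List ℕ) :
    |descSum (prefixInd d) m w - 2 ^ m * blockFreq d| ≤ 2 ^ m := by
  have h0 : 0 ≤ descSum (prefixInd d) m w := by
    rw [← mul_zero ((2 : ℝ) ^ m), ← descSum_const 0 m w]
    exact descSum_mono fun v => by unfold prefixInd; split_ifs <;> norm_num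
  have h1 : descSum (prefixInd d) m w ≤ 2 ^ m := by
    rw [← mul_one ((2 : ℝ) ^ m), ← descSum_const 1 m w]
    exact descSum_mono fun v => by unfold prefixInd; split_ifs <;> norm_num
  have hp : (0 : ℝ) < 2 ^ m := by positivity
  have h2 := mul_le_of_le_one_right hp.le (blockFreq_le_one d)
  have h3 := mul_pos hp (blockFreq_pos d)
  rw [abs_le]
  constructor <;> linarith

lemma descSum_prefixInd_eq {d : List ℕ} (hd : ∀ a ∈ d, 1 ≤ a) {m : ℕ} (hm : d.sum ≤ m)
    {w : List ℕ} (hw : ∀ a ∈ w, 1 ≤ a) :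
    descSum (prefixInd d) m w = 2 ^ m * blockFreq d := by
  obtain ⟨m, rfl⟩ := Nat.exists_eq_add_of_le' hm
  rw [descSum_prefixInd hd m hw, blockFreq, pow_add, mul_assoc, mul_inv_cancel₀ (by positivity),
    mul_one]

/-- The discrepancy, not counting an occurrence at the beginning of the word. -/
noncomputable def innerDiscrepancy (d v : List ℕ) : ℝ := discrepancy d v - prefixInd d v

/-- The left child has the interior occurrences and the length of `v`. In the right child an
occurrence at the start of `v` becomes interior, and the extra letter costs `blockFreq d`. -/
lemma innerDiscrepancy_children (d v : List ℕ) :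
    innerDiscrepancy d (incrHead v) + innerDiscrepancy d (1 :: v)
      = 2 * innerDiscrepancy d v + (prefixInd d v + -blockFreq d) := by
  cases v with
  | nil =>
    by_cases hd : d = [] <;> simp [innerDiscrepancy, discrepancy, prefixInd, incrHead, occ, hd]
    ring_nf
  | cons a v =>
    simp only [innerDiscrepancy, discrepancy, prefixInd, incrHead, occ, List.length_cons]
    push_cast
    ring_nf

lemma descSum_innerDiscrepancy_succ (d : List ℕ) (m : ℕ) (w : List ℕ) :
    descSum (innerDiscrepancy d) (m + 1) w = 2 * descSum (innerDiscrepancy d) m w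
      + (descSum (prefixInd d) m w - 2 ^ m * blockFreq d) := by
  rw [descSum_succ]
  simp only [innerDiscrepancy_children]
  rw [descSum_add, descSum_const_mul, descSum_add, descSum_const]
  ring

lemma abs_descSum_innerDiscrepancy_le {d : List ℕ} (hd : ∀ a ∈ d, 1 ≤ a) (m : ℕ) {w : List ℕ}
    (hw : ∀ a ∈ w, 1 ≤ a) :
    |descSum (innerDiscrepancy d) m w| ≤ 2 ^ m * (w.length + 1 + min m d.sum : ℕ) := by
  induction m with
  | zero =>
    have h := abs_le.1 (abs_discrepancy_le d w)
    have h0 : 0 ≤ prefixInd d w := by unfold prefixInd; split_ifs <;> norm_num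
    have h1 : prefixInd d w ≤ 1 := by unfold prefixInd; split_ifs <;> norm_num
    simp only [descSum, descendants, List.map_singleton, List.sum_singleton, innerDiscrepancy]
    rw [abs_le, Nat.zero_min, add_zero, pow_zero, one_mul, Nat.cast_add, Nat.cast_one]
    constructor <;> linarith
  | succ m ih =>
    rw [descSum_innerDiscrepancy_succ]
    have hp : (0 : ℝ) < 2 ^ m := by positivity
    -- From depth `d.sum` on the error term vanishes and the average per word no longer grows;
    -- before that each level adds at most `1`.
    rcases le_or_gt d.sum m with hm | hm
    · rw [descSum_prefixInd_eq hd hm hw, sub_self, add_zero, abs_mul, abs_two, pow_succ,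
        min_eq_right (by omega)]
      rw [min_eq_right hm] at ih
      linarith
    · have h := abs_descSum_prefixInd_sub_le d m w
      have h2 := abs_add_le (2 * descSum (innerDiscrepancy d) m w)
        (descSum (prefixInd d) m w - 2 ^ m * blockFreq d)
      rw [abs_mul, abs_two] at h2
      rw [min_eq_left (by omega), pow_succ]
      rw [min_eq_left hm.le] at ih
      push_cast at ih ⊢
      linarith

/-- Per word: `w.length + 1 + d.sum` from the interior, `2` from occurrences at the start,
`d.length` from the seam. -/
lemma abs_discrepancy_descendants_le {d : List ℕ} (hd : ∀ a ∈ d, 1 ≤ a) (m : ℕ) {w : List ℕ}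
    (hw : ∀ a ∈ w, 1 ≤ a) :
    |discrepancy d (descendants m w).flatten|
      ≤ 2 ^ m * (w.length + 3 + d.sum + d.length : ℕ) := by
  have hp : (0 : ℝ) < 2 ^ m := by positivity
  have h1 := abs_discrepancy_flatten_sub_le d (descendants m w)
  have h2 := abs_descSum_innerDiscrepancy_le hd m hw
  have h3 := abs_descSum_prefixInd_sub_le d m w
  have h4 : ((descendants m w).map (discrepancy d)).sum
      = descSum (innerDiscrepancy d) m w + descSum (prefixInd d) m w := by
    rw [← descSum_add]
    simp [innerDiscrepancy, descSum]
  have h5 : ((w.length + 1 + min m d.sum : ℕ) : ℝ) ≤ (w.length + 1 + d.sum : ℕ) := by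
    exact_mod_cast by omega
  have h6 := mul_le_mul_of_nonneg_left h5 hp.le
  have h7 := mul_le_of_le_one_right hp.le (blockFreq_le_one d)
  have h8 := mul_pos hp (blockFreq_pos d)
  rw [length_descendants, h4] at h1
  push_cast at *
  rw [abs_le] at *
  constructor <;> linarith

lemma prefix_append_cases {u v w : List ℕ} (h : u <+: v ++ w) :
    u <+: v ∨ ∃ t, t <+: w ∧ u = v ++ t := by
  rcases List.prefix_or_prefix_of_prefix h (List.prefix_append v w) with h1 | ⟨t, rfl⟩
  · exact Or.inl h1
  · exact Or.inr ⟨t, (List.prefix_append_right_inj v).1 h, rfl⟩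

/-- A prefix either stays in the left subtree, or contains all of it and continues into the right
one, whose root is one letter longer. With `s = d.sum` and `k = d.length`, the constant `C = 4 + s +
2 * k` solves `(3 + s + k) + (1 + C) + k = 2 * C`: left subtree, right part, seam. -/
lemma abs_discrepancy_prefix_descendants_le {d : List ℕ} (hd : ∀ a ∈ d, 1 ≤ a) (m : ℕ) :
    ∀ {w : List ℕ}, (∀ a ∈ w, 1 ≤ a) → ∀ {u : List ℕ}, u <+: (descendants m w).flatten →
    |discrepancy d u| ≤ 2 ^ m * (w.length + (4 + d.sum + 2 * d.length) : ℕ) := by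
  induction m with
  | zero =>
    intro w hw u hu
    simp only [descendants, List.flatten_cons, List.flatten_nil, List.append_nil] at hu
    have h1 : (u.length : ℝ) ≤ w.length := by exact_mod_cast hu.length_le
    have h2 : (0 : ℝ) ≤ (4 + d.sum + 2 * d.length : ℕ) := Nat.cast_nonneg _
    have := abs_discrepancy_le d u
    rw [pow_zero, one_mul, Nat.cast_add]
    linarith
  | succ m ih =>
    intro w hw u hu
    have hp : (1 : ℝ) ≤ 2 ^ m := one_le_pow₀ one_le_two
    have hw1 : ∀ a ∈ incrHead w, 1 ≤ a :=
      pos_of_mem_descendants 1 hw _ (by simp [descendants])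
    have hw2 : ∀ a ∈ 1 :: w, 1 ≤ a :=
      pos_of_mem_descendants 1 hw _ (by simp [descendants])
    rw [descendants, List.flatten_append] at hu
    rcases prefix_append_cases hu with h | ⟨t, ht, rfl⟩
    · have := ih hw1 h
      rw [length_incrHead] at this
      refine this.trans (mul_le_mul_of_nonneg_right ?_ (Nat.cast_nonneg _))
      exact pow_le_pow_right₀ one_le_two (Nat.le_succ m)
    · have h1 := ih hw2 ht
      have h2 := abs_discrepancy_descendants_le hd m hw1
      have h3 := abs_discrepancy_append_le d (descendants m (incrHead w)).flatten t
      have h4 : (d.length : ℝ) ≤ 2 ^ m * d.length :=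
        le_mul_of_one_le_left (Nat.cast_nonneg _) hp
      rw [length_incrHead] at h2
      rw [List.length_cons] at h1
      rw [pow_succ]
      push_cast at *
      linarith

/-! ### The concatenated sequence -/

lemma keplerDigitList_succ (L : ℕ) :
    keplerDigitList (L + 1) = keplerDigitList L ++ (descendants L [2]).flatten := by
  rw [keplerDigitList, List.range_succ, List.flatMap_append, ← map_cfList_keplerLevel]
  simp [keplerDigitList, List.flatMap_def]

/-- Only right children are longer than their parents, so the mean word length grows by `1 / 2` per
level; this is the factor that beats the discrepancy. -/
lemma two_mul_length_flatten_descendants (m : ℕ) : ∀ w : List ℕ,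
    2 * (descendants m w).flatten.length = 2 ^ m * (2 * w.length + m) := by
  induction m with
  | zero => intro w; simp [descendants]
  | succ m ih =>
    intro w
    rw [descendants, List.flatten_append, List.length_append, mul_add, ih, ih, length_incrHead,
      List.length_cons]
    ring

lemma two_mul_length_keplerDigitList (L : ℕ) :
    2 * (keplerDigitList L).length = 2 ^ L * L := by
  induction L with
  | zero => simp [keplerDigitList]
  | succ L ih =>
    rw [keplerDigitList_succ, List.length_append, mul_add, ih, two_mul_length_flatten_descendants,
      List.length_singleton]
    ring

lemma le_length_keplerDigitList (L : ℕ) : L ≤ (keplerDigitList L).length := by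
  have h := two_mul_length_keplerDigitList L
  cases L with
  | zero => exact Nat.zero_le _
  | succ L => nlinarith [Nat.one_le_two_pow (n := L), pow_succ 2 L]

lemma keplerDigitList_prefix {L M : ℕ} (h : L ≤ M) : keplerDigitList L <+: keplerDigitList M := by
  induction M, h using Nat.le_induction with
  | base => exact List.prefix_rfl
  | succ M _ ih => rw [keplerDigitList_succ]; exact ih.trans (List.prefix_append _ _)

lemma keplerDigitList_getElem? {L n : ℕ} (h : n < (keplerDigitList L).length) :
    (keplerDigitList L)[n]? = some (keplerDigit n) := by
  have h' : n < (keplerDigitList (n + 1)).length := le_length_keplerDigitList (n + 1)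
  rw [keplerDigit, List.getD_eq_getElem _ _ h', ← List.getElem?_eq_getElem h']
  rcases le_total L (n + 1) with hl | hl
  · exact (List.getElem?_eq_getElem h).trans
      (List.prefix_iff_getElem?.1 (keplerDigitList_prefix hl) n h).symm
  · exact (List.prefix_iff_getElem?.1 (keplerDigitList_prefix hl) n h').trans
      (List.getElem?_eq_getElem h').symm

lemma map_keplerDigit_range {L n : ℕ} (h : n ≤ (keplerDigitList L).length) :
    (List.range n).map keplerDigit = (keplerDigitList L).take n := by
  apply List.ext_getElem?
  intro i
  rw [List.getElem?_take, List.getElem?_map]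
  split_ifs with hi
  · rw [keplerDigitList_getElem? (hi.trans_le h), List.getElem?_range hi, Option.map_some]
  · rw [List.getElem?_eq_none (by simpa using hi), Option.map_none]

lemma one_le_of_mem_keplerDigitList {L a : ℕ} (h : a ∈ keplerDigitList L) : 1 ≤ a := by
  induction L with
  | zero => simp [keplerDigitList] at h
  | succ L ih =>
    rw [keplerDigitList_succ, List.mem_append, List.mem_flatten] at h
    obtain h | ⟨v, hv, ha⟩ := h
    · exact ih h
    · exact pos_of_mem_descendants L (by simp) v hv a ha

lemma one_le_keplerDigit (n : ℕ) : 1 ≤ keplerDigit n :=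
  one_le_of_mem_keplerDigitList
    (List.mem_of_getElem? (keplerDigitList_getElem? (le_length_keplerDigitList (n + 1))))

lemma abs_discrepancy_keplerDigitList_le {d : List ℕ} (hd : ∀ a ∈ d, 1 ≤ a) (L : ℕ) :
    |discrepancy d (keplerDigitList L)| ≤ 2 ^ L * (4 + d.sum + 2 * d.length : ℕ) := by
  induction L with
  | zero =>
    refine (abs_discrepancy_le d _).trans ?_
    rw [keplerDigitList, List.range_zero, List.flatMap_nil, List.length_nil, Nat.cast_zero]
    positivity
  | succ L ih =>
    have hp : (1 : ℝ) ≤ 2 ^ L := one_le_pow₀ one_le_two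
    have h1 := abs_discrepancy_append_le d (keplerDigitList L) (descendants L [2]).flatten
    have h2 := abs_discrepancy_descendants_le hd L (w := [2]) (by simp)
    have h4 : (d.length : ℝ) ≤ 2 ^ L * d.length :=
      le_mul_of_one_le_left (Nat.cast_nonneg _) hp
    rw [keplerDigitList_succ, pow_succ]
    rw [List.length_singleton] at h2
    push_cast at *
    linarith

/-- The constant adds `4 + d.sum + 2 * d.length` for the complete levels, one more than this for the
cut level (its root `[2]` has length `1`), and `d.length` for the seam. -/
lemma abs_discrepancy_keplerDigit_le {d : List ℕ} (hd : ∀ a ∈ d, 1 ≤ a) {L n : ℕ}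
    (h1 : (keplerDigitList L).length ≤ n) (h2 : n ≤ (keplerDigitList (L + 1)).length) :
    |discrepancy d ((List.range n).map keplerDigit)|
      ≤ 2 ^ L * (9 + 2 * d.sum + 5 * d.length : ℕ) := by
  have hp : (1 : ℝ) ≤ 2 ^ L := one_le_pow₀ one_le_two
  rw [map_keplerDigit_range h2, keplerDigitList_succ, List.take_append, List.take_of_length_le h1]
  have h3 := abs_discrepancy_prefix_descendants_le hd L (w := [2]) (by simp)
    (List.take_prefix (n - (keplerDigitList L).length) (descendants L [2]).flatten)
  have h4 := abs_discrepancy_keplerDigitList_le hd L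
  have h5 := abs_discrepancy_append_le d (keplerDigitList L)
    ((descendants L [2]).flatten.take (n - (keplerDigitList L).length))
  have h6 : (d.length : ℝ) ≤ 2 ^ L * d.length :=
    le_mul_of_one_le_left (Nat.cast_nonneg _) hp
  rw [List.length_singleton] at h3
  push_cast at *
  linarith

lemma exists_level {L n : ℕ} (h : (keplerDigitList L).length ≤ n) :
    ∃ M, L ≤ M ∧ (keplerDigitList M).length ≤ n ∧ n ≤ (keplerDigitList (M + 1)).length := by
  induction n, h using Nat.le_induction with
  | base => exact ⟨L, le_rfl, le_rfl, (keplerDigitList_prefix (Nat.le_succ L)).length_le⟩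
  | succ n _ ih =>
    obtain ⟨M, h1, h2, h3⟩ := ih
    rcases h3.lt_or_eq with h3 | h3
    · exact ⟨M, h1, by omega, h3⟩
    -- When `n` exactly fills the levels up to `M`, the next digit falls in level `M + 1`, which is
    -- nonempty.
    · have h4 := two_mul_length_flatten_descendants (M + 1) [2]
      have h5 : 0 < 2 ^ (M + 1) * (2 * [2].length + (M + 1)) := by positivity
      refine ⟨M + 1, by omega, by omega, ?_⟩
      rw [keplerDigitList_succ (M + 1), List.length_append]
      omega

lemma tendsto_occ_keplerDigit {d : List ℕ} (hd : ∀ a ∈ d, 1 ≤ a) :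
    Tendsto (fun n : ℕ => (occ d ((List.range n).map keplerDigit) : ℝ) / n) atTop
      (𝓝 (blockFreq d)) := by
  rw [Metric.tendsto_atTop]
  intro ε hε
  -- With `C` the constant of `abs_discrepancy_keplerDigit_le`, the error is at most `2 ^ M * C` and
  -- `n ≥ 2 ^ M * M / 2`, so `2 * C / L < ε` suffices once `M ≥ L`.
  obtain ⟨L, hL⟩ := exists_nat_gt ((2 * (9 + 2 * d.sum + 5 * d.length : ℕ) : ℝ) / ε)
  refine ⟨(keplerDigitList (L + 1)).length, fun n hn => ?_⟩
  obtain ⟨M, hM, h1, h2⟩ := exists_level hn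
  have h := abs_discrepancy_keplerDigit_le hd h1 h2
  have hn1 : 1 ≤ n := by have := le_length_keplerDigitList (L + 1); omega
  have hn0 : (0 : ℝ) < n := by exact_mod_cast hn1
  have hlen : (2 : ℝ) ^ M * M ≤ 2 * n := by
    exact_mod_cast (two_mul_length_keplerDigitList M).symm.le.trans (by omega)
  have hLM : (L : ℝ) ≤ M := by exact_mod_cast (by omega : L ≤ M)
  have hp : (0 : ℝ) < 2 ^ M := by positivity
  rw [div_lt_iff₀ hε] at hL
  rw [Real.dist_eq]
  have e : (occ d ((List.range n).map keplerDigit) : ℝ) / n - blockFreq d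
      = discrepancy d ((List.range n).map keplerDigit) / n := by
    rw [discrepancy, List.length_map, List.length_range]
    field_simp
  rw [e, abs_div, abs_of_pos hn0, div_lt_iff₀ hn0]
  refine h.trans_lt ?_
  have h3 : 2 * (9 + 2 * d.sum + 5 * d.length : ℕ) < (M : ℝ) * ε :=
    hL.trans_le (mul_le_mul_of_nonneg_right hLM hε.le)
  have h4 := mul_lt_mul_of_pos_left h3 hp
  have h5 := mul_le_mul_of_nonneg_right hlen hε.le
  linarith

/-! ### Normality -/

lemma ofFn_prefix_map_range {k : ℕ} (d : Fin k → ℕ) (f : ℕ → ℕ) (n : ℕ) :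
    List.ofFn d <+: (List.range n).map f ↔ k ≤ n ∧ ∀ j : Fin k, f j = d j := by
  rw [List.prefix_iff_getElem]
  simp only [List.length_ofFn, List.length_map, List.length_range, List.getElem_ofFn,
    List.getElem_map, List.getElem_range]
  constructor
  · rintro ⟨h, h'⟩
    exact ⟨h, fun j => (h' j j.2).symm⟩
  · rintro ⟨h, h'⟩
    exact ⟨h, fun j hj => (h' ⟨j, hj⟩).symm⟩

lemma occ_map_range {k : ℕ} (d : Fin k → ℕ) (n : ℕ) : ∀ f : ℕ → ℕ,
    occ (List.ofFn d) ((List.range n).map f)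
      = {i ∈ Finset.range n | i + k ≤ n ∧ ∀ j : Fin k, f (i + j) = d j}.card := by
  induction n with
  | zero => intro f; rfl
  | succ n ih =>
    intro f
    have e : (List.range (n + 1)).map f = f 0 :: (List.range n).map fun i => f (i + 1) := by
      rw [List.range_succ_eq_map, List.map_cons, List.map_map]
      rfl
    -- Folding `e` back turns the test at the head into a prefix test on `(List.range (n + 1)).map
    -- f`, the term `i = 0` of the count.
    rw [e, occ, ← e, ih, Finset.card_filter, Finset.card_filter, Finset.sum_range_succ', add_comm]
    simp only [ofFn_prefix_map_range, zero_add]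
    congr 1
    refine Finset.sum_congr rfl fun i _ => ?_
    have : ∀ j : Fin k, i + 1 + (j : ℕ) = i + j + 1 := fun j => by omega
    simp only [this, show i + 1 + k ≤ n + 1 ↔ i + k ≤ n by omega]

theorem isMinkowskiNormal_of_cfDigit_eq {x : ℝ} (hx : x ∈ Set.Ico (0 : ℝ) 1)
    (h : ∀ n, cfDigit x n = keplerDigit n) : IsMinkowskiNormal x := by
  refine ⟨hx, fun k d _ hd => ?_⟩
  have hm := minkowskiMeasure_real_cylinder hd
  refine ⟨?_, hm⟩
  have ht := tendsto_occ_keplerDigit (d := List.ofFn d) (by simpa [List.mem_ofFn] using hd)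
  rw [blockFreq, List.sum_ofFn] at ht
  rw [hm]
  refine ht.congr fun n => ?_
  rw [occ_map_range, blockCount]
  simp only [h]

lemma keplerContFract_convs : keplerContFract.convs = cfEval keplerDigit :=
  natContFract_convs one_le_keplerDigit

lemma keplerNumber_eq : keplerNumber = cfValue keplerDigit := by
  rw [keplerNumber, keplerContFract_convs, cfValue]

end MinkowskiNormality

theorem mainTheorem1 :
    Tendsto MinkowskiNormality.keplerContFract.convs atTop (𝓝 MinkowskiNormality.keplerNumber) ∧
      Irrational MinkowskiNormality.keplerNumber ∧
      (∀ n : ℕ, MinkowskiNormality.cfDigit MinkowskiNormality.keplerNumber n =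
        MinkowskiNormality.keplerDigit n) ∧
      MinkowskiNormality.IsMinkowskiNormal MinkowskiNormality.keplerNumber := by
  open MinkowskiNormality in
  have hd : ∀ n, cfDigit keplerNumber n = keplerDigit n := fun n => by
    rw [keplerNumber_eq]; exact cfDigit_cfValue n one_le_keplerDigit
  refine ⟨?_, irrational_of_cfDigit_pos fun n => (hd n).symm ▸ one_le_keplerDigit n, hd,
    isMinkowskiNormal_of_cfDigit_eq ?_ hd⟩
  · rw [keplerNumber_eq, keplerContFract_convs]
    exact tendsto_cfEval one_le_keplerDigit
  · rw [keplerNumber_eq]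
    exact ⟨cfValue_nonneg one_le_keplerDigit, cfValue_lt_one one_le_keplerDigit⟩
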